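/- Let $M$ and $N$ be closed (compact, without boundary) connected smooth surfaces, possibly nonorientable. For a continuous map $f\colon M\to N$ between closed connected smooth surfaces, the geometric degree $\mathrm{Deg}\,f$ is the minimal cardinality $|h^{-1}(y)|$ over all smooth maps $h\colon M\to N$ homotopic to $f$ and all regular values $y\in N$ of $h$ (points outside the image of $h$ count as regular values). Let $k$ be a natural number and let $q\colon N'\to N$ be a $k$-sheeted smooth covering (a covering map of smooth surfaces that is a local diffeomorphism and each of whose fibres has exactly $k$ points) with $N'$ connected; then $N'$ is again a closed surface. Let $f\colon M\to N$ be a continuous map that lifts to $N'$, i.e. there is a continuous map $f'\colon M\to N'$ with $f=q\circ f'$. Then $$\mathrm{Deg}\,f = k\cdot \mathrm{Deg}\,f'.$$ -/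

import Mathlib

open scoped Manifold ContDiff

/-- `y` is a regular value of `h : M → N` (surfaces): the differential of `h` is surjective at every
point of the fibre over `y`. Points outside the image are regular values. -/
def IsRegularValue {M N : Type*}
    [TopologicalSpace M] [ChartedSpace (EuclideanSpace ℝ (Fin 2)) M]
    [TopologicalSpace N] [ChartedSpace (EuclideanSpace ℝ (Fin 2)) N]
    (h : M → N) (y : N) : Prop :=
  ∀ x : M, h x = y → Function.Surjective (mfderiv (𝓡 2) (𝓡 2) h x)

/-- The geometric degree `Deg f` of a continuous map of surfaces: the minimal cardinality of
`h ⁻¹' {y}`, where `h` runs over the smooth maps homotopic to `f` and `y` over the regular values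
of `h`. The minimum is taken in `ℕ∞`, so that an infinite fibre, or the absence of any competitor,
would not be mistaken for a fibre of cardinality `0`. -/
noncomputable def geometricDegree {M N : Type*}
    [TopologicalSpace M] [ChartedSpace (EuclideanSpace ℝ (Fin 2)) M]
    [TopologicalSpace N] [ChartedSpace (EuclideanSpace ℝ (Fin 2)) N]
    (f : C(M, N)) : ℕ∞ :=
  sInf {d : ℕ∞ | ∃ (h : C(M, N)) (y : N), ContMDiff (𝓡 2) (𝓡 2) ∞ h ∧
    ContinuousMap.Homotopic f h ∧ IsRegularValue h y ∧ (h ⁻¹' {y}).encard = d}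

/-- A `k`-sheeted covering of smooth surfaces: a covering map that is a local diffeomorphism and
all of whose fibres have exactly `k` elements. -/
structure IsSheetedCovering {N' N : Type*}
    [TopologicalSpace N'] [ChartedSpace (EuclideanSpace ℝ (Fin 2)) N']
    [TopologicalSpace N] [ChartedSpace (EuclideanSpace ℝ (Fin 2)) N]
    (k : ℕ) (q : N' → N) : Prop where
  isCoveringMap : IsCoveringMap q
  isLocalDiffeomorph : IsLocalDiffeomorph (𝓡 2) (𝓡 2) ∞ q
  encard_fiber : ∀ y : N, (q ⁻¹' {y}).encard = k

open Set Topology Filter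

section InverseFunction

variable {E : Type*} [NormedAddCommGroup E] [NormedSpace ℝ E]
  {M N : Type*} [TopologicalSpace M] [ChartedSpace E M] [TopologicalSpace N] [ChartedSpace E N]

/-- Surjectivity of the manifold derivative can be tested in charts. -/
lemma surjective_mfderiv_iff_surjective_fderiv_chart [IsManifold 𝓘(ℝ, E) 1 M]
    [IsManifold 𝓘(ℝ, E) 1 N] {h : M → N} (x : M) {z : M}
    (hh : MDifferentiableAt 𝓘(ℝ, E) 𝓘(ℝ, E) h z)
    (hz : z ∈ (extChartAt 𝓘(ℝ, E) x).source) (hhz : h z ∈ (extChartAt 𝓘(ℝ, E) (h x)).source)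
    (hF : DifferentiableAt ℝ (writtenInExtChartAt 𝓘(ℝ, E) 𝓘(ℝ, E) x h)
      (extChartAt 𝓘(ℝ, E) x z)) :
    Function.Surjective (mfderiv 𝓘(ℝ, E) 𝓘(ℝ, E) h z) ↔
      Function.Surjective (fderiv ℝ (writtenInExtChartAt 𝓘(ℝ, E) 𝓘(ℝ, E) x h)
        (extChartAt 𝓘(ℝ, E) x z)) := by
  set φ := extChartAt 𝓘(ℝ, E) x
  set ψ := extChartAt 𝓘(ℝ, E) (h x)
  set F := writtenInExtChartAt 𝓘(ℝ, E) 𝓘(ℝ, E) x h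
  have hφ : MDifferentiableAt 𝓘(ℝ, E) 𝓘(ℝ, E) φ z :=
    mdifferentiableAt_extChartAt (by simpa [φ] using hz)
  have hψ : MDifferentiableAt 𝓘(ℝ, E) 𝓘(ℝ, E) ψ (h z) :=
    mdifferentiableAt_extChartAt (by simpa [ψ] using hhz)
  have e1 : ψ ∘ h =ᶠ[𝓝 z] F ∘ φ := by
    filter_upwards [(isOpen_extChartAt_source (I := 𝓘(ℝ, E)) x).mem_nhds hz] with w hw
    change ψ (h w) = ψ (h (φ.symm (φ w)))
    rw [φ.left_inv hw]
  have e2 : (mfderiv 𝓘(ℝ, E) 𝓘(ℝ, E) ψ (h z)).comp (mfderiv 𝓘(ℝ, E) 𝓘(ℝ, E) h z) =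
      (fderiv ℝ F (φ z)).comp (mfderiv 𝓘(ℝ, E) 𝓘(ℝ, E) φ z) := by
    rw [← mfderiv_comp z hψ hh, e1.mfderiv_eq, mfderiv_comp z hF.mdifferentiableAt hφ,
      mfderiv_eq_fderiv]
    rfl
  have bφ : Function.Bijective (mfderiv 𝓘(ℝ, E) 𝓘(ℝ, E) φ z) := by
    obtain ⟨A, hA⟩ := isInvertible_mfderiv_extChartAt (I := 𝓘(ℝ, E)) hz
    rw [← hA]; exact A.bijective
  have bψ : Function.Bijective (mfderiv 𝓘(ℝ, E) 𝓘(ℝ, E) ψ (h z)) := by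
    obtain ⟨A, hA⟩ := isInvertible_mfderiv_extChartAt (I := 𝓘(ℝ, E)) hhz
    rw [← hA]; exact A.bijective
  have e3 : mfderiv 𝓘(ℝ, E) 𝓘(ℝ, E) ψ (h z) ∘ mfderiv 𝓘(ℝ, E) 𝓘(ℝ, E) h z =
      fderiv ℝ F (φ z) ∘ mfderiv 𝓘(ℝ, E) 𝓘(ℝ, E) φ z := funext fun v => DFunLike.congr_fun e2 v
  constructor
  · intro hs
    have : Function.Surjective (fderiv ℝ F (φ z) ∘ mfderiv 𝓘(ℝ, E) 𝓘(ℝ, E) φ z) := by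
      rw [← e3]; exact bψ.2.comp hs
    exact this.of_comp
  · intro hs
    have : Function.Surjective (mfderiv 𝓘(ℝ, E) 𝓘(ℝ, E) ψ (h z) ∘ mfderiv 𝓘(ℝ, E) 𝓘(ℝ, E) h z) := by
      rw [e3]; exact hs.comp bφ.2
    exact this.of_comp_left bψ.1

/-- A smooth map between manifolds of the same dimension is injective and submersive near every
point where its derivative is onto. -/
lemma exists_isOpen_injOn_surjective_mfderiv [FiniteDimensional ℝ E] [IsManifold 𝓘(ℝ, E) 1 M]
    [IsManifold 𝓘(ℝ, E) 1 N] {h : M → N} (hh : ContMDiff 𝓘(ℝ, E) 𝓘(ℝ, E) 1 h) {x : M}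
    (hx : Function.Surjective (mfderiv 𝓘(ℝ, E) 𝓘(ℝ, E) h x)) :
    ∃ W : Set M, IsOpen W ∧ x ∈ W ∧ InjOn h W ∧
      ∀ z ∈ W, Function.Surjective (mfderiv 𝓘(ℝ, E) 𝓘(ℝ, E) h z) := by
  have : CompleteSpace E := FiniteDimensional.complete ℝ E
  set φ := extChartAt 𝓘(ℝ, E) x with hφdef
  set ψ := extChartAt 𝓘(ℝ, E) (h x) with hψdef
  set F := writtenInExtChartAt 𝓘(ℝ, E) 𝓘(ℝ, E) x h with hFdef
  have hF : ContDiffAt ℝ 1 F (φ x) := by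
    have := (contMDiffAt_iff.1 (hh x)).2
    rwa [modelWithCornersSelf_coe, range_id, contDiffWithinAt_univ] at this
  have hs : Function.Surjective (fderiv ℝ F (φ x)) :=
    (surjective_mfderiv_iff_surjective_fderiv_chart x ((hh x).mdifferentiableAt one_ne_zero)
      (mem_extChartAt_source x) (mem_extChartAt_source (h x))
      (hF.differentiableAt one_ne_zero)).1 hx
  have hi : Function.Injective (fderiv ℝ F (φ x)) :=
    (LinearMap.injective_iff_surjective (f := (fderiv ℝ F (φ x)).toLinearMap)).2 hs
  let A : E ≃L[ℝ] E := ContinuousLinearEquiv.ofBijective (fderiv ℝ F (φ x))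
    (LinearMap.ker_eq_bot.2 hi) (LinearMap.range_eq_top.2 hs)
  have hA : (A : E →L[ℝ] E) = fderiv ℝ F (φ x) := by ext; rfl
  have hsd : HasStrictFDerivAt F (A : E →L[ℝ] E) (φ x) := by
    rw [hA]; exact hF.hasStrictFDerivAt one_ne_zero
  obtain ⟨V, hV, hVinj⟩ : ∃ V ∈ 𝓝 (φ x), InjOn F V :=
    ⟨_, (hsd.toOpenPartialHomeomorph F).open_source.mem_nhds
      hsd.mem_toOpenPartialHomeomorph_source, (hsd.toOpenPartialHomeomorph F).injOn⟩
  have hreg : ∀ᶠ w in 𝓝 (φ x), DifferentiableAt ℝ F w ∧ Function.Surjective (fderiv ℝ F w) := by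
    have h1 : ∀ᶠ w in 𝓝 (φ x), ContDiffAt ℝ 1 F w := hF.eventually (by simp)
    have hc : ContinuousAt (fderiv ℝ F) (φ x) := (hF.fderiv_right (m := 0) (by simp)).continuousAt
    have h2 : ∀ᶠ w in 𝓝 (φ x), fderiv ℝ F w ∈ range ((↑) : (E ≃L[ℝ] E) → E →L[ℝ] E) :=
      hc (by rw [← hA]; exact ContinuousLinearEquiv.nhds A)
    filter_upwards [h1, h2] with w hw1 hw2
    refine ⟨hw1.differentiableAt one_ne_zero, ?_⟩
    obtain ⟨B, hB⟩ := hw2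
    rw [← hB]; exact B.surjective
  have hev : ∀ᶠ z in 𝓝 x, z ∈ φ.source ∧ h z ∈ ψ.source ∧ φ z ∈ V ∧
      DifferentiableAt ℝ F (φ z) ∧ Function.Surjective (fderiv ℝ F (φ z)) := by
    filter_upwards [extChartAt_source_mem_nhds (I := 𝓘(ℝ, E)) x,
      hh.continuous.continuousAt (extChartAt_source_mem_nhds (I := 𝓘(ℝ, E)) (h x)),
      continuousAt_extChartAt (I := 𝓘(ℝ, E)) x hV,
      (continuousAt_extChartAt (I := 𝓘(ℝ, E)) x).eventually hreg] with z h1 h2 h3 h4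
    exact ⟨h1, h2, h3, h4⟩
  obtain ⟨W, hW, hWo, hxW⟩ := mem_nhds_iff.1 hev
  refine ⟨W, hWo, hxW, fun z hz w hw hzw => ?_, fun z hz => ?_⟩
  · have hz := hW hz
    have hw := hW hw
    refine φ.injOn hz.1 hw.1 (hVinj hz.2.2.1 hw.2.2.1 ?_)
    change ψ (h (φ.symm (φ z))) = ψ (h (φ.symm (φ w)))
    rw [φ.left_inv hz.1, φ.left_inv hw.1, hzw]
  · have hz := hW hz
    exact (surjective_mfderiv_iff_surjective_fderiv_chart x
      ((hh z).mdifferentiableAt one_ne_zero) hz.1 hz.2.1 hz.2.2.2.1).2 hz.2.2.2.2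

end InverseFunction

/-- Near a regular value, every value is regular and has at most as many preimages. -/
lemma exists_isOpen_isRegularValue_encard_le {M N : Type*}
    [TopologicalSpace M] [ChartedSpace (EuclideanSpace ℝ (Fin 2)) M] [IsManifold (𝓡 2) ∞ M]
    [CompactSpace M]
    [TopologicalSpace N] [ChartedSpace (EuclideanSpace ℝ (Fin 2)) N] [IsManifold (𝓡 2) ∞ N]
    [T2Space N] {h : M → N} (hh : ContMDiff (𝓡 2) (𝓡 2) ∞ h) {y : N} (hy : IsRegularValue h y) :
    ∃ U : Set N, IsOpen U ∧ y ∈ U ∧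
      ∀ u ∈ U, IsRegularValue h u ∧ (h ⁻¹' {u}).encard ≤ (h ⁻¹' {y}).encard := by
  have : IsManifold (𝓡 2) 1 M := IsManifold.of_le (n := ∞) (by simp)
  have : IsManifold (𝓡 2) 1 N := IsManifold.of_le (n := ∞) (by simp)
  have key : ∀ x : h ⁻¹' {y}, ∃ W : Set M, IsOpen W ∧ x.1 ∈ W ∧ InjOn h W ∧
      ∀ z ∈ W, Function.Surjective (mfderiv (𝓡 2) (𝓡 2) h z) := fun x =>
    exists_isOpen_injOn_surjective_mfderiv (hh.of_le (by simp)) (hy x.1 x.2)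
  choose W hWo hxW hinj hsurj using key
  have hC : IsCompact (⋃ x, W x)ᶜ := (isOpen_iUnion hWo).isClosed_compl.isCompact
  refine ⟨(h '' (⋃ x, W x)ᶜ)ᶜ, (hC.image hh.continuous).isClosed.isOpen_compl, ?_, fun u hu => ?_⟩
  · rintro ⟨x, hx, hxy⟩
    exact hx (mem_iUnion.2 ⟨⟨x, hxy⟩, hxW ⟨x, hxy⟩⟩)
  · have hmem : ∀ z, h z = u → ∃ x, z ∈ W x := fun z hz => by
      by_contra hcon
      exact hu ⟨z, by simpa using hcon, hz⟩
    refine ⟨fun z hz => ?_, ?_⟩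
    · obtain ⟨x, hx⟩ := hmem z hz
      exact hsurj x z hx
    · rcases (h ⁻¹' {u}).eq_empty_or_nonempty with he | ⟨z₀, hz₀⟩
      · simp [he]
      have : Nonempty (h ⁻¹' {y}) := ⟨(hmem z₀ hz₀).choose⟩
      choose! c hc using hmem
      refine encard_le_encard_of_injOn (f := fun z => (c z).1) (fun z _ => (c z).2) ?_
      intro z hz w hw hzw
      have hz' := hc z hz
      rw [Subtype.ext hzw] at hz'
      exact hinj _ hz' (hc w hw) (Eq.trans hz hw.symm)

section PushingPoints

/-- In a finite-dimensional space, points near `x₀` can be pushed to `x₀` by a diffeomorphism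
isotopic to the identity through maps supported in a prescribed neighbourhood of `x₀`. -/
lemma exists_diffeomorph_isotopic_pushing {E : Type*} [NormedAddCommGroup E] [NormedSpace ℝ E]
    [FiniteDimensional ℝ E] (x₀ : E) {O : Set E} (hO : O ∈ 𝓝 x₀) :
    ∃ K ⊆ O, IsCompact K ∧ ∃ δ > 0, ∀ a ∈ Metric.ball x₀ δ,
      ∃ (G : unitInterval × E → E) (g : E ≃ₘ^∞⟮𝓘(ℝ, E), 𝓘(ℝ, E)⟯ E),
        Continuous G ∧ (∀ x, G (0, x) = x) ∧ (∀ x, G (1, x) = g x) ∧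
        (∀ t, ∀ x ∉ K, G (t, x) = x) ∧ (∀ t, ∀ x ∈ K, G (t, x) ∈ O) ∧ g a = x₀ := by
  have : CompleteSpace E := FiniteDimensional.complete ℝ E
  obtain ⟨R, hR, hRO⟩ := Metric.nhds_basis_closedBall.mem_iff.1 hO
  let ρ : ContDiffBump x₀ := ⟨R / 4, R / 2, by positivity, by linarith⟩
  have hρ : ContDiff ℝ ∞ ρ := ρ.contDiff
  obtain ⟨C, hC⟩ := hρ.lipschitzWith_of_hasCompactSupport ρ.hasCompactSupport (by simp)
  refine ⟨Metric.closedBall x₀ (R / 2), (Metric.closedBall_subset_closedBall (by linarith)).trans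
    hRO, isCompact_closedBall _ _, min (R / 4) (1 / (2 * (C + 1))), by positivity,
    fun a ha => ?_⟩
  rw [Metric.mem_ball, lt_min_iff] at ha
  obtain ⟨ha1, ha2⟩ := ha
  set v : E := x₀ - a with hv
  have hv1 : ‖v‖ < R / 4 := by rwa [hv, ← dist_eq_norm, dist_comm]
  have hv2 : C * ‖v‖ ≤ 1 / 2 := by
    have h1 : ‖v‖ < 1 / (2 * (C + 1)) := by rwa [hv, ← dist_eq_norm, dist_comm]
    rw [lt_div_iff₀ (by positivity)] at h1
    nlinarith [norm_nonneg v, C.2]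
  let f : E → E := fun x => x + ρ x • v
  have hf : ContDiff ℝ ∞ f := contDiff_id.add (hρ.smul contDiff_const)
  have happ : ApproximatesLinearOn f ((ContinuousLinearEquiv.refl ℝ E : E ≃L[ℝ] E) : E →L[ℝ] E)
      univ (1 / 2) := by
    intro x _ y _
    have h1 : f x - f y - (x - y) = (ρ x - ρ y) • v := by
      simp only [f, sub_smul]; abel
    have h2 := hC.dist_le_mul x y
    rw [dist_eq_norm, dist_eq_norm] at h2
    change ‖f x - f y - (x - y)‖ ≤ _
    rw [h1, norm_smul]
    calc ‖ρ x - ρ y‖ * ‖v‖ ≤ C * ‖x - y‖ * ‖v‖ := by gcongr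
      _ = C * ‖v‖ * ‖x - y‖ := by ring
      _ ≤ 1 / 2 * ‖x - y‖ := by gcongr
      _ = _ := by simp
  have hc : Subsingleton E ∨ (1 / 2 : NNReal) <
      ‖((ContinuousLinearEquiv.refl ℝ E).symm : E →L[ℝ] E)‖₊⁻¹ := by
    rcases subsingleton_or_nontrivial E with h | h
    · exact Or.inl h
    · right
      have : ‖((ContinuousLinearEquiv.refl ℝ E).symm : E →L[ℝ] E)‖₊ = 1 :=
        NNReal.eq (ContinuousLinearMap.norm_id (𝕜 := ℝ) (E := E))
      rw [this, inv_one]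
      exact NNReal.half_lt_self one_ne_zero
  let Φ : E ≃ₜ E := happ.toHomeomorph f hc
  have hΦ : (Φ : E → E) = f := rfl
  have hder : ∀ x, ∃ D : E ≃L[ℝ] E, HasFDerivAt Φ (D : E →L[ℝ] E) x := by
    intro x
    have hρ' : HasFDerivAt ρ (fderiv ℝ ρ x) x := (hρ.differentiable (by simp) x).hasFDerivAt
    have hD : HasFDerivAt f (ContinuousLinearMap.id ℝ E + (fderiv ℝ ρ x).smulRight v) x :=
      (hasFDerivAt_id x).add (hρ'.smul_const v)
    set D := ContinuousLinearMap.id ℝ E + (fderiv ℝ ρ x).smulRight v with hDdef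
    have hinj : Function.Injective D := by
      refine (injective_iff_map_eq_zero D).2 fun w hw => ?_
      have h1 : w = -(fderiv ℝ ρ x w • v) := eq_neg_of_add_eq_zero_left hw
      have h2 : ‖fderiv ℝ ρ x w‖ ≤ C * ‖w‖ :=
        (fderiv ℝ ρ x).le_of_opNorm_le (norm_fderiv_le_of_lipschitz ℝ hC) w
      have h3 : ‖w‖ ≤ 1 / 2 * ‖w‖ :=
        calc ‖w‖ = ‖fderiv ℝ ρ x w‖ * ‖v‖ := by conv_lhs => rw [h1, norm_neg, norm_smul]
          _ ≤ C * ‖w‖ * ‖v‖ := by gcongr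
          _ = C * ‖v‖ * ‖w‖ := by ring
          _ ≤ _ := by gcongr
      exact norm_le_zero_iff.1 (by linarith)
    have hsurj : Function.Surjective D :=
      (LinearMap.injective_iff_surjective (f := D.toLinearMap)).1 hinj
    exact ⟨ContinuousLinearEquiv.ofBijective D (LinearMap.ker_eq_bot.2 hinj)
      (LinearMap.range_eq_top.2 hsurj), hD⟩
  choose D hD using hder
  let g : E ≃ₘ^∞⟮𝓘(ℝ, E), 𝓘(ℝ, E)⟯ E :=
    { Φ.toEquiv with
      contMDiff_toFun := hf.contMDiff
      contMDiff_invFun := (Φ.contDiff_symm hD hf).contMDiff }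
  refine ⟨fun p => p.2 + (p.1 : ℝ) • ρ p.2 • v, g, ?_, ?_, ?_, ?_, ?_, ?_⟩
  · have := ρ.continuous
    fun_prop
  · simp
  · intro x
    change _ = f x
    simp [f]
  · intro t x hx
    have : ρ x = 0 := ρ.zero_of_le_dist (by simpa [ρ] using (not_le.1 hx).le)
    simp [this]
  · intro t x hx
    apply hRO
    rw [Metric.mem_closedBall, dist_eq_norm] at hx ⊢
    have h1 : ‖(t : ℝ) • ρ x • v‖ ≤ ‖v‖ := by
      rw [norm_smul, norm_smul, Real.norm_of_nonneg t.2.1, Real.norm_of_nonneg ρ.nonneg]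
      have := mul_le_one₀ t.2.2 ρ.nonneg (ρ.le_one (x := x))
      nlinarith [norm_nonneg v]
    calc ‖x + (t : ℝ) • ρ x • v - x₀‖ = ‖(x - x₀) + (t : ℝ) • ρ x • v‖ := by congr 1; abel
      _ ≤ ‖x - x₀‖ + ‖(t : ℝ) • ρ x • v‖ := norm_add_le _ _
      _ ≤ R := by linarith
  · change a + ρ a • v = x₀
    rw [ρ.one_of_mem_closedBall (by simpa [ρ] using ha1.le), hv]
    simp

open Classical in
/-- Transport a self-map of the model space to a manifold through a chart `e`, extending it by
the identity outside the domain of `e`. -/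
noncomputable def OpenPartialHomeomorph.conjExtend {X E : Type*} [TopologicalSpace X]
    [TopologicalSpace E] (e : OpenPartialHomeomorph X E) (g : E → E) (x : X) : X :=
  if x ∈ e.source then e.symm (g (e x)) else x

namespace OpenPartialHomeomorph

section Topology

variable {X E : Type*} [TopologicalSpace X] [TopologicalSpace E] (e : OpenPartialHomeomorph X E)

lemma conjExtend_of_mem (g : E → E) {x : X} (hx : x ∈ e.source) :
    e.conjExtend g x = e.symm (g (e x)) := if_pos hx

variable {K : Set E} {g : E → E}

lemma conjExtend_of_notMem (hg : ∀ y ∉ K, g y = y) {x : X} (hx : x ∉ e.symm '' K) :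
    e.conjExtend g x = x := by
  by_cases hs : x ∈ e.source
  · rw [e.conjExtend_of_mem g hs, hg _ fun hK => hx ⟨e x, hK, e.left_inv hs⟩, e.left_inv hs]
  · exact if_neg hs

lemma isOpen_compl_symm_image [T2Space X] (hK : IsCompact K) (hKe : K ⊆ e.target) :
    IsOpen (e.symm '' K)ᶜ :=
  (hK.image_of_continuousOn (e.continuousOn_symm.mono hKe)).isClosed.isOpen_compl

lemma mem_compl_symm_image_of_notMem_source (hKe : K ⊆ e.target) {x : X} (hx : x ∉ e.source) :
    x ∈ (e.symm '' K)ᶜ := by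
  rintro ⟨y, hy, rfl⟩
  exact hx (e.map_target (hKe hy))

lemma mapsTo_target_of_eqOn_compl (hg : ∀ y ∉ K, g y = y) (hgK : ∀ y ∈ K, g y ∈ e.target) :
    MapsTo g e.target e.target := fun y hy => by
  by_cases h : y ∈ K
  · exact hgK y h
  · rwa [hg y h]

lemma conjExtend_conjExtend {g' : E → E} (h : Function.LeftInverse g' g)
    (hg : MapsTo g e.target e.target) : Function.LeftInverse (e.conjExtend g') (e.conjExtend g) := by
  intro x
  by_cases hs : x ∈ e.source
  · have ht := hg (e.map_source hs)
    rw [e.conjExtend_of_mem g hs, e.conjExtend_of_mem _ (e.map_target ht), e.right_inv ht, h,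
      e.left_inv hs]
  · have : e.conjExtend g x = x := if_neg hs
    rw [this]
    exact if_neg hs

lemma continuous_conjExtend [T2Space X] {T : Type*} [TopologicalSpace T] {G : T × E → E}
    (hG : Continuous G) (hK : IsCompact K) (hKe : K ⊆ e.target)
    (hg : ∀ t, ∀ y ∉ K, G (t, y) = y) (hgK : ∀ t, ∀ y ∈ K, G (t, y) ∈ e.target) :
    Continuous fun p : T × X => e.conjExtend (fun y => G (p.1, y)) p.2 := by
  refine continuous_iff_continuousAt.2 fun ⟨t, x⟩ => ?_
  by_cases hs : x ∈ e.source
  · have hev : (fun p : T × X => e.symm (G (p.1, e p.2))) =ᶠ[𝓝 (t, x)]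
        fun p : T × X => e.conjExtend (fun y => G (p.1, y)) p.2 := by
      filter_upwards [continuousAt_snd (e.open_source.mem_nhds hs)] with p hp
      exact (e.conjExtend_of_mem (fun y => G (p.1, y)) hp).symm
    refine ContinuousAt.congr ?_ hev
    have h1 : ContinuousAt (fun p : T × X => G (p.1, e p.2)) (t, x) :=
      hG.continuousAt.comp (continuousAt_fst.prodMk
        (ContinuousAt.comp (x := (t, x)) (e.continuousAt hs) continuousAt_snd))
    exact ContinuousAt.comp (x := (t, x)) (e.continuousAt_symm
      (e.mapsTo_target_of_eqOn_compl (hg t) (hgK t) (e.map_source hs))) h1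
  · have hev : (fun p : T × X => p.2) =ᶠ[𝓝 (t, x)]
        fun p : T × X => e.conjExtend (fun y => G (p.1, y)) p.2 := by
      filter_upwards [continuousAt_snd ((e.isOpen_compl_symm_image hK hKe).mem_nhds
        (e.mem_compl_symm_image_of_notMem_source hKe hs))] with p hp
      exact (e.conjExtend_of_notMem (hg p.1) hp).symm
    exact continuousAt_snd.congr hev

end Topology

lemma contMDiff_conjExtend {E X : Type*} [NormedAddCommGroup E] [NormedSpace ℝ E]
    [TopologicalSpace X] [T2Space X] [ChartedSpace E X] [IsManifold 𝓘(ℝ, E) ∞ X]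
    {e : OpenPartialHomeomorph X E} (he : e ∈ IsManifold.maximalAtlas 𝓘(ℝ, E) ∞ X)
    {K : Set E} {g : E → E} (hgs : ContMDiff 𝓘(ℝ, E) 𝓘(ℝ, E) ∞ g) (hK : IsCompact K)
    (hKe : K ⊆ e.target) (hg : ∀ y ∉ K, g y = y) (hgK : ∀ y ∈ K, g y ∈ e.target) :
    ContMDiff 𝓘(ℝ, E) 𝓘(ℝ, E) ∞ (e.conjExtend g) := by
  intro x
  by_cases hs : x ∈ e.source
  · have hev : e.conjExtend g =ᶠ[𝓝 x] e.symm ∘ g ∘ e := by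
      filter_upwards [e.open_source.mem_nhds hs] with z hz
      exact e.conjExtend_of_mem g hz
    refine ContMDiffAt.congr_of_eventuallyEq ?_ hev
    have ht := e.mapsTo_target_of_eqOn_compl hg hgK (e.map_source hs)
    exact (contMDiffAt_symm_of_mem_maximalAtlas he ht).comp x
      ((hgs (e x)).comp x (contMDiffAt_of_mem_maximalAtlas he hs))
  · have hev : e.conjExtend g =ᶠ[𝓝 x] id := by
      filter_upwards [(e.isOpen_compl_symm_image hK hKe).mem_nhds
        (e.mem_compl_symm_image_of_notMem_source hKe hs)] with z hz
      exact e.conjExtend_of_notMem hg hz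
    exact contMDiffAt_id.congr_of_eventuallyEq hev

end OpenPartialHomeomorph

variable {E X : Type*} [NormedAddCommGroup E] [NormedSpace ℝ E] [FiniteDimensional ℝ E]
  [TopologicalSpace X] [T2Space X] [ChartedSpace E X] [IsManifold 𝓘(ℝ, E) ∞ X]

/-- Points of a manifold near `p` can be pushed to `p` by a diffeomorphism that is homotopic to the
identity and supported in a prescribed neighbourhood of `p`. -/
lemma exists_diffeomorph_homotopic_id_pushing (p : X) {W : Set X} (hW : W ∈ 𝓝 p) :
    ∃ V ∈ 𝓝 p, ∀ a ∈ V, ∃ χ : X ≃ₘ^∞⟮𝓘(ℝ, E), 𝓘(ℝ, E)⟯ X,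
      ContinuousMap.Homotopic (ContinuousMap.id X) χ.toHomeomorph ∧ χ a = p ∧
        ∀ x ∉ W, χ x = x := by
  set e := chartAt E p with he
  have hemax : e ∈ IsManifold.maximalAtlas 𝓘(ℝ, E) ∞ X := IsManifold.chart_mem_maximalAtlas p
  have hps : p ∈ e.source := mem_chart_source E p
  have hpt : e p ∈ e.target := mem_chart_target E p
  have hO : e.target ∩ e.symm ⁻¹' W ∈ 𝓝 (e p) :=
    inter_mem (e.open_target.mem_nhds hpt)
      (e.continuousAt_symm hpt (by rwa [e.left_inv hps]))
  obtain ⟨K, hKO, hK, δ, hδ, H⟩ := exists_diffeomorph_isotopic_pushing (e p) hO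
  refine ⟨e.source ∩ e ⁻¹' Metric.ball (e p) δ, inter_mem (e.open_source.mem_nhds hps)
    (e.continuousAt hps (Metric.ball_mem_nhds _ hδ)), fun a ha => ?_⟩
  obtain ⟨G, g, hG, hG0, hG1, hGK, hGO, hga⟩ := H (e a) ha.2
  have hKe : K ⊆ e.target := hKO.trans inter_subset_left
  have hg : ∀ y ∉ K, g y = y := fun y hy => by rw [← hG1, hGK 1 y hy]
  have hgK : ∀ y ∈ K, g y ∈ e.target := fun y hy => by rw [← hG1]; exact (hGO 1 y hy).1
  have hg' : ∀ y ∉ K, g.symm y = y := fun y hy => by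
    conv_lhs => rw [← hg y hy, g.symm_apply_apply]
  have hgK' : ∀ y ∈ K, g.symm y ∈ e.target := fun y hy => by
    by_contra hcon
    have h1 := hg _ fun h => hcon (hKe h)
    rw [g.apply_symm_apply] at h1
    exact hcon (h1 ▸ hKe hy)
  let χ : X ≃ₘ^∞⟮𝓘(ℝ, E), 𝓘(ℝ, E)⟯ X :=
    { toFun := e.conjExtend g
      invFun := e.conjExtend g.symm
      left_inv := e.conjExtend_conjExtend g.symm_apply_apply
        (e.mapsTo_target_of_eqOn_compl hg hgK)
      right_inv := e.conjExtend_conjExtend g.apply_symm_apply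
        (e.mapsTo_target_of_eqOn_compl hg' hgK')
      contMDiff_toFun := OpenPartialHomeomorph.contMDiff_conjExtend hemax g.contMDiff hK hKe hg hgK
      contMDiff_invFun :=
        OpenPartialHomeomorph.contMDiff_conjExtend hemax g.symm.contMDiff hK hKe hg' hgK' }
  refine ⟨χ, ⟨⟨⟨fun q => e.conjExtend (fun y => G (q.1, y)) q.2, e.continuous_conjExtend hG hK hKe
    hGK fun t y hy => (hGO t y hy).1⟩, fun x => ?_, fun x => ?_⟩⟩, ?_, fun x hx => ?_⟩
  · change e.conjExtend (fun y => G (0, y)) x = x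
    exact e.conjExtend_of_notMem (K := ∅) (fun y _ => hG0 y) (by simp)
  · change e.conjExtend (fun y => G (1, y)) x = e.conjExtend g x
    simp_rw [hG1]
  · change e.conjExtend g a = p
    rw [e.conjExtend_of_mem _ ha.1, hga, e.left_inv hps]
  · refine e.conjExtend_of_notMem hg ?_
    rintro ⟨y, hy, rfl⟩
    exact hx (hKO hy).2

/-- In a connected manifold every finite set can be brought into a given nonempty open set by a
diffeomorphism homotopic to the identity. -/
lemma exists_diffeomorph_homotopic_id_finite_subset_image [PreconnectedSpace X] {U : Set X}
    (hU : IsOpen U) (hUne : U.Nonempty) {F : Set X} (hF : F.Finite) :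
    ∃ φ : X ≃ₘ^∞⟮𝓘(ℝ, E), 𝓘(ℝ, E)⟯ X,
      ContinuousMap.Homotopic (ContinuousMap.id X) φ.toHomeomorph ∧ F ⊆ φ '' U := by
  induction F, hF using Set.Finite.induction_on with
  | empty => exact ⟨Diffeomorph.refl _ _ _, ContinuousMap.Homotopic.refl _, empty_subset _⟩
  | @insert p F hpF hF ih =>
    let A : Set X := {p | ∃ φ : X ≃ₘ^∞⟮𝓘(ℝ, E), 𝓘(ℝ, E)⟯ X,
      ContinuousMap.Homotopic (ContinuousMap.id X) φ.toHomeomorph ∧ insert p F ⊆ φ '' U}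
    suffices hA : A = univ by
      have hpA : p ∈ A := hA ▸ mem_univ p
      exact hpA
    obtain ⟨φ₀, hφ₀, hFφ₀⟩ := ih
    refine IsClopen.eq_univ ⟨isClosed_of_closure_subset fun p hp => ?_, isOpen_iff_mem_nhds.2 ?_⟩ ?_
    · by_cases hpF : p ∈ F
      · exact ⟨φ₀, hφ₀, by rwa [insert_eq_of_mem hpF]⟩
      obtain ⟨V, hV, H⟩ := exists_diffeomorph_homotopic_id_pushing (E := E) p
        (hF.isClosed.isOpen_compl.mem_nhds hpF)
      obtain ⟨a, haV, φ, hφ, haφ⟩ := mem_closure_iff_nhds.1 hp V hV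
      obtain ⟨χ, hχ, hχa, hχF⟩ := H a haV
      refine ⟨φ.trans χ, hχ.comp hφ, ?_⟩
      rw [Diffeomorph.coe_trans, image_comp]
      rintro x (rfl | hx)
      · exact ⟨a, haφ (mem_insert _ _), hχa⟩
      · exact ⟨x, haφ (mem_insert_of_mem _ hx), hχF x fun h => h hx⟩
    · rintro p ⟨φ, hφ, hpφ⟩
      have hopen : IsOpen (φ '' U) := φ.toHomeomorph.isOpenMap U hU
      refine mem_of_superset (hopen.mem_nhds (hpφ (mem_insert _ _))) fun b hb => ⟨φ, hφ, ?_⟩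
      exact insert_subset hb ((subset_insert _ _).trans hpφ)
    · obtain ⟨u, hu⟩ := hUne
      exact ⟨φ₀ u, φ₀, hφ₀, insert_subset (mem_image_of_mem _ hu) hFφ₀⟩

end PushingPoints

lemma IsCoveringMap.t2Space {E X : Type*} [TopologicalSpace E] [TopologicalSpace X] [T2Space X]
    {p : E → X} (hp : IsCoveringMap p) : T2Space E := by
  refine ⟨fun x y hxy => ?_⟩
  by_cases h : p x = p y
  · exact hp.isSeparatedMap x y h hxy
  · exact separated_by_continuous hp.continuous h

lemma IsLocalDiffeomorph.bijective_mfderiv {𝕜 E F H G M N : Type*} [NontriviallyNormedField 𝕜]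
    [NormedAddCommGroup E] [NormedSpace 𝕜 E] [NormedAddCommGroup F] [NormedSpace 𝕜 F]
    [TopologicalSpace H] [TopologicalSpace G] {I : ModelWithCorners 𝕜 E H}
    {J : ModelWithCorners 𝕜 F G} [TopologicalSpace M] [ChartedSpace H M] [TopologicalSpace N]
    [ChartedSpace G N] {n : ℕ∞ω} {f : M → N} (hf : IsLocalDiffeomorph I J n f) (hn : n ≠ 0)
    (x : M) : Function.Bijective (mfderiv I J f x) := by
  rw [← hf.mfderivToContinuousLinearEquiv_coe hn x]
  exact (hf.mfderivToContinuousLinearEquiv hn x).bijective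

/-- A continuous lift of a smooth map through a local diffeomorphism is smooth. -/
lemma IsLocalDiffeomorph.contMDiff_of_comp {𝕜 E F E' H G H' M N P : Type*}
    [NontriviallyNormedField 𝕜] [NormedAddCommGroup E] [NormedSpace 𝕜 E] [NormedAddCommGroup F]
    [NormedSpace 𝕜 F] [NormedAddCommGroup E'] [NormedSpace 𝕜 E'] [TopologicalSpace H]
    [TopologicalSpace G] [TopologicalSpace H'] {I : ModelWithCorners 𝕜 E H}
    {J : ModelWithCorners 𝕜 F G} {I' : ModelWithCorners 𝕜 E' H'}
    [TopologicalSpace M] [ChartedSpace H M] [TopologicalSpace N] [ChartedSpace G N]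
    [TopologicalSpace P] [ChartedSpace H' P] {n : ℕ∞ω} {q : M → N}
    (hq : IsLocalDiffeomorph I J n q) {g : P → M} (hg : Continuous g)
    (hqg : ContMDiff I' J n (q ∘ g)) : ContMDiff I' I n g := by
  intro x
  have hq' := hq (g x)
  have hev : g =ᶠ[𝓝 x] hq'.localInverse ∘ (q ∘ g) := by
    filter_upwards [hg.continuousAt.eventually hq'.localInverse_eventuallyEq_left] with z hz
    exact hz.symm
  exact (ContMDiffAt.comp x hq'.localInverse_contMDiffAt (hqg x)).congr_of_eventuallyEq hev

section GeometricDegree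

variable {M N N' : Type*}
  [TopologicalSpace M] [ChartedSpace (EuclideanSpace ℝ (Fin 2)) M]
  [TopologicalSpace N] [ChartedSpace (EuclideanSpace ℝ (Fin 2)) N]
  [TopologicalSpace N'] [ChartedSpace (EuclideanSpace ℝ (Fin 2)) N']

/-- A value of `q ∘ g`, with `q` a local diffeomorphism, is regular iff all its preimages under `q`
are regular values of `g`. -/
lemma IsLocalDiffeomorph.isRegularValue_comp_iff {q : N' → N}
    (hq : IsLocalDiffeomorph (𝓡 2) (𝓡 2) ∞ q) {g : M → N'} (hg : ContMDiff (𝓡 2) (𝓡 2) ∞ g)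
    (y : N) : IsRegularValue (q ∘ g) y ↔ ∀ z ∈ q ⁻¹' {y}, IsRegularValue g z := by
  have key : ∀ x, Function.Surjective (mfderiv (𝓡 2) (𝓡 2) (q ∘ g) x) ↔
      Function.Surjective (mfderiv (𝓡 2) (𝓡 2) g x) := fun x => by
    rw [mfderiv_comp x (hq.mdifferentiable (by simp) (g x)) (hg.mdifferentiable (by simp) x)]
    have hb := hq.bijective_mfderiv (by simp) (g x)
    exact ⟨fun h => Function.Surjective.of_comp_left h hb.1, fun h => hb.2.comp h⟩
  constructor
  · rintro h z hz x rfl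
    exact (key x).1 (h x hz)
  · exact fun h x hx => (key x).2 (h (g x) hx x rfl)

/-- A homotopy from `q ∘ f'` to `h` lifts to a homotopy from `f'` to a lift of `h`. -/
lemma IsCoveringMap.exists_lift_of_homotopic {A X Y : Type*} [TopologicalSpace A]
    [TopologicalSpace X] [TopologicalSpace Y] {q : Y → X} (hq : IsCoveringMap q) {f h : C(A, X)}
    (H : f.Homotopic h) {f' : C(A, Y)} (hf : ∀ x, f x = q (f' x)) :
    ∃ h' : C(A, Y), f'.Homotopic h' ∧ ∀ x, h x = q (h' x) := by
  obtain ⟨H⟩ := H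
  have H0 : ∀ a, H.toContinuousMap (0, a) = q (f' a) := fun a => (H.apply_zero a).trans (hf a)
  let L := hq.liftHomotopy H.toContinuousMap f' H0
  refine ⟨L.comp ((ContinuousMap.const A 1).prodMk (ContinuousMap.id A)),
    ⟨⟨L, hq.liftHomotopy_zero _ f' H0, fun x => rfl⟩⟩, fun x => ?_⟩
  exact (H.apply_one x).symm.trans (congrFun (hq.liftHomotopy_lifts _ f' H0) (1, x)).symm

lemma geometricDegree_le {f h : C(M, N)} {y : N} (hh : ContMDiff (𝓡 2) (𝓡 2) ∞ h)
    (H : f.Homotopic h) (hy : IsRegularValue h y) :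
    geometricDegree f ≤ (h ⁻¹' {y}).encard :=
  sInf_le ⟨h, y, hh, H, hy, rfl⟩

lemma mul_geometricDegree_le {f : C(M, N)} {k : ℕ} {q : N' → N} (hq : IsSheetedCovering k q)
    {f' : C(M, N')} (hf : ∀ x : M, f x = q (f' x)) :
    k * geometricDegree f' ≤ geometricDegree f := by
  refine le_sInf ?_
  rintro d ⟨h, y, hh, H, hy, rfl⟩
  obtain ⟨h', H', hh'⟩ := hq.isCoveringMap.exists_lift_of_homotopic H hf
  have hcomp : (h : M → N) = q ∘ h' := funext hh'
  have hs : ContMDiff (𝓡 2) (𝓡 2) ∞ h' :=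
    hq.isLocalDiffeomorph.contMDiff_of_comp h'.continuous (hcomp ▸ hh)
  rw [hcomp, hq.isLocalDiffeomorph.isRegularValue_comp_iff hs] at hy
  have hfin : (q ⁻¹' {y}).Finite := finite_of_encard_eq_coe (hq.encard_fiber y)
  have hU : (h : M → N) ⁻¹' {y} = ⋃ z ∈ q ⁻¹' {y}, h' ⁻¹' {z} := by
    ext x; simp [hcomp]
  rw [hU, hfin.encard_biUnion fun a _ b _ hab => Disjoint.preimage _ (by simpa using hab),
    finsum_mem_eq_finite_toFinset_sum _ hfin]
  have hcard : ((hfin.toFinset.card : ℕ) : ℕ∞) = k := by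
    rw [← hq.encard_fiber y, hfin.encard_eq_coe_toFinset_card]
  rw [← hcard, ← nsmul_eq_mul]
  exact Finset.card_nsmul_le_sum _ _ _ fun z hz =>
    geometricDegree_le hs H' (hy z (hfin.mem_toFinset.1 hz))

lemma geometricDegree_le_mul [IsManifold (𝓡 2) ∞ M] [CompactSpace M] [T2Space N]
    [IsManifold (𝓡 2) ∞ N'] [PreconnectedSpace N'] {f : C(M, N)} {k : ℕ} {q : N' → N}
    (hq : IsSheetedCovering k q) {f' : C(M, N')} (hf : ∀ x : M, f x = q (f' x))
    {h : C(M, N')} {y : N'} (hh : ContMDiff (𝓡 2) (𝓡 2) ∞ h) (H : f'.Homotopic h)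
    (hy : IsRegularValue h y) :
    geometricDegree f ≤ k * (h ⁻¹' {y}).encard := by
  have : T2Space N' := hq.isCoveringMap.t2Space
  obtain ⟨U, hU, hyU, hreg⟩ := exists_isOpen_isRegularValue_encard_le hh hy
  have hfin : (q ⁻¹' {q y}).Finite := finite_of_encard_eq_coe (hq.encard_fiber (q y))
  obtain ⟨φ, hφ, hφU⟩ := exists_diffeomorph_homotopic_id_finite_subset_image
    (E := EuclideanSpace ℝ (Fin 2)) hU ⟨y, hyU⟩ hfin
  let Q : C(N', N) := ⟨q, hq.isCoveringMap.continuous⟩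
  let g : C(M, N') := (φ.toHomeomorph : C(N', N')).comp h
  have hg : ContMDiff (𝓡 2) (𝓡 2) ∞ g := φ.contMDiff.comp hh
  have hfQ : f = Q.comp f' := ContinuousMap.ext hf
  have hhg : h.Homotopic g := hφ.comp (ContinuousMap.Homotopic.refl h)
  have hpre : ∀ u, g ⁻¹' {φ u} = h ⁻¹' {u} := fun u => by
    ext x
    exact φ.injective.eq_iff
  have hgreg : IsRegularValue (Q.comp g) (q y) := by
    refine (hq.isLocalDiffeomorph.isRegularValue_comp_iff hg _).2 fun z hz => ?_
    obtain ⟨u, hu, rfl⟩ := hφU hz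
    refine (φ.isLocalDiffeomorph.isRegularValue_comp_iff hh _).2 fun w hw => ?_
    rw [φ.injective hw]
    exact (hreg u hu).1
  have hun : Q.comp g ⁻¹' {q y} = ⋃ z ∈ q ⁻¹' {q y}, g ⁻¹' {z} := by
    ext x; simp [Q]
  have hcard : ((hfin.toFinset.card : ℕ) : ℕ∞) = k := by
    rw [← hq.encard_fiber (q y), hfin.encard_eq_coe_toFinset_card]
  calc geometricDegree f ≤ (Q.comp g ⁻¹' {q y}).encard :=
        geometricDegree_le (hq.isLocalDiffeomorph.contMDiff.comp hg)
          (hfQ ▸ (ContinuousMap.Homotopic.refl Q).comp (H.trans hhg)) hgreg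
    _ ≤ ∑ z ∈ hfin.toFinset, (g ⁻¹' {z}).encard := by
        rw [hun]
        refine (hfin.encard_biUnion_le _).trans_eq (finsum_mem_eq_finite_toFinset_sum _ hfin)
    _ ≤ hfin.toFinset.card • (h ⁻¹' {y}).encard := by
        refine Finset.sum_le_card_nsmul _ _ _ fun z hz => ?_
        obtain ⟨u, hu, rfl⟩ := hφU (hfin.mem_toFinset.1 hz)
        rw [hpre]
        exact (hreg u hu).2
    _ = k * (h ⁻¹' {y}).encard := by rw [nsmul_eq_mul, hcard]

end GeometricDegree

theorem mainTheorem6 {M N N' : Type*}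
    [TopologicalSpace M] [ChartedSpace (EuclideanSpace ℝ (Fin 2)) M] [IsManifold (𝓡 2) ∞ M]
    [T2Space M] [CompactSpace M] [ConnectedSpace M]
    [TopologicalSpace N] [ChartedSpace (EuclideanSpace ℝ (Fin 2)) N] [IsManifold (𝓡 2) ∞ N]
    [T2Space N] [CompactSpace N] [ConnectedSpace N]
    [TopologicalSpace N'] [ChartedSpace (EuclideanSpace ℝ (Fin 2)) N'] [IsManifold (𝓡 2) ∞ N']
    [ConnectedSpace N']
    (f : C(M, N)) (k : ℕ) (q : N' → N) (hq : IsSheetedCovering k q)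
    (f' : C(M, N')) (hf : ∀ x : M, f x = q (f' x)) :
    geometricDegree f = (k : ℕ∞) * geometricDegree f' := by
  refine le_antisymm ?_ (mul_geometricDegree_le hq hf)
  have hk : (k : ℕ∞) ≠ 0 := fun hk => by
    obtain ⟨z⟩ : Nonempty N' := inferInstance
    have h := hq.encard_fiber (q z)
    rw [hk, encard_eq_zero] at h
    exact (h ▸ mem_singleton (q z) : z ∈ (∅ : Set N'))
  rcases Set.eq_empty_or_nonempty {d : ℕ∞ | ∃ (h : C(M, N')) (y : N'),
    ContMDiff (𝓡 2) (𝓡 2) ∞ h ∧ ContinuousMap.Homotopic f' h ∧ IsRegularValue h y ∧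
      (h ⁻¹' {y}).encard = d} with he | hne
  · rw [geometricDegree.eq_def f', he, sInf_empty, ENat.mul_top hk]
    exact le_top
  · obtain ⟨h, y, hh, H, hy, hd⟩ := csInf_mem hne
    rw [geometricDegree.eq_def f', ← hd]
    exact geometricDegree_le_mul hq hf hh H hy
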